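/- Let $m>0$ and $s\in(0,1)$. Let $\mathcal F$ be the unitary Fourier transform on $L^2(\mathbb R^3,\mathbb C)$, i.e. the continuous extension of $\mathcal Fu(\xi)=(2\pi)^{-3/2}\int_{\mathbb R^3}e^{-ix\cdot\xi}u(x)\,dx$. Let $$H^s(\mathbb R^3,\mathbb C)=\{u\in L^2(\mathbb R^3,\mathbb C): |\xi|^s\mathcal Fu\in L^2(\mathbb R^3,\mathbb C)\},\qquad \|u\|_{H^s}=\Big(\int_{\mathbb R^3}(|\xi|^{2s}+m^{2s})|\mathcal Fu(\xi)|^2\,d\xi\Big)^{1/2},$$ and let $H^s_m(\mathbb R^3,\mathbb C)$ be the completion of $C_c^\infty(\mathbb R^3,\mathbb C)$ with respect to the norm $$\|u\|_{H^s_m}=\Big(\int_{\mathbb R^3}(|\xi|^2+m^2)^s|\mathcal Fu(\xi)|^2\,d\xi\Big)^{1/2}.$$ Let $\mathcal K_\nu(\zeta)=\frac12\left(\frac\zeta2\right)^\nu\int_0^{+\infty}e^{-\frac{\zeta^2}{4t}-t}\,t^{-1-\nu}\,dt$ $(\zeta>0)$ be the modified Bessel function of the third kind of order $\nu$, and let $C_s=\dfrac{s\,2^{\frac{2s-1}{2}}}{\pi^{3/2}\,\Gamma(1-s)}$.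 Then $H^s(\mathbb R^3,\mathbb C)=H^s_m(\mathbb R^3,\mathbb C)$, in the sense that the identity of $C_c^\infty(\mathbb R^3,\mathbb C)$ extends to a linear bijection of $H^s_m(\mathbb R^3,\mathbb C)$ onto $H^s(\mathbb R^3,\mathbb C)$; the norms $\|\cdot\|_{H^s}$ and $\|\cdot\|_{H^s_m}$ are equivalent, that is, there are constants $c,C>0$ with $c\|u\|_{H^s}\le\|u\|_{H^s_m}\le C\|u\|_{H^s}$ for all $u\in H^s(\mathbb R^3,\mathbb C)$; and, for every $u\in H^s(\mathbb R^3,\mathbb C)$, the following integrals are finite and $$\|u\|_{H^s_m}=\Big(\int_{\mathbb R^3}(|\xi|^2+m^2)^s|\mathcal Fu(\xi)|^2\,d\xi\Big)^{1/2}=\left(\frac{C_s}{2}m^{\frac{3+2s}{2}}\int_{\mathbb R^3\times\mathbb R^3}\frac{|u(x)-u(y)|^2}{|x-y|^{\frac{3+2s}{2}}}\,\mathcal K_{\frac{3+2s}{2}}(m|x-y|)\,dx\,dy+m^{2s}\int_{\mathbb R^3}|u(x)|^2\,dx\right)^{1/2}.$$ -/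

import Mathlib

open MeasureTheory
open scoped FourierTransform Distributions

noncomputable section

namespace PseudoRel

/-- Three-dimensional Euclidean space. -/
abbrev R3 : Type := EuclideanSpace ℝ (Fin 3)

/-- The complex space `L²(ℝ³, ℂ)`. -/
abbrev L2 : Type := Lp ℂ 2 (volume : Measure R3)

/-- The unitary Fourier transform on `L²(ℝ³, ℂ)`, that is the continuous extension of
`F u (ξ) = (2π)^(-3/2) ∫ exp(-i x·ξ) u(x) dx`. Mathlib's transform `𝓕` on `L²` extends
`∫ exp(-2πi x·ξ) u(x) dx`, hence the rescaling. -/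
def fourier (u : L2) (ξ : R3) : ℂ :=
  (((2 * Real.pi) ^ (-(3 / 2) : ℝ) : ℝ) : ℂ) * (𝓕 u : L2) ((2 * Real.pi)⁻¹ • ξ)

/-- The modified Bessel function of the third kind (Macdonald function)
`K_ν(ζ) = (1/2) (ζ/2)^ν ∫₀^∞ exp(-ζ²/(4t) - t) t^(-1-ν) dt`, for `ζ > 0`. -/
def besselK (ν ζ : ℝ) : ℝ :=
  1 / 2 * (ζ / 2) ^ ν * ∫ t in Set.Ioi (0 : ℝ), Real.exp (-ζ ^ 2 / (4 * t) - t) * t ^ (-1 - ν)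

/-- The constant `C_s = s 2^((2s-1)/2) / (π^(3/2) Γ(1-s))`. -/
def Cs (s : ℝ) : ℝ :=
  s * 2 ^ ((2 * s - 1) / 2) / (Real.pi ^ (3 / 2 : ℝ) * Real.Gamma (1 - s))

/-- The norm of `H^s`: the square root of `∫ (|ξ|^(2s) + m^(2s)) |F u(ξ)|² dξ`. -/
def hsNorm (s m : ℝ) (u : L2) : ℝ :=
  √(∫ ξ : R3, (‖ξ‖ ^ (2 * s) + m ^ (2 * s)) * ‖fourier u ξ‖ ^ 2)

/-- The norm of `H^s_m`: the square root of `∫ (|ξ|² + m²)^s |F u(ξ)|² dξ`. -/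
def hsmNorm (s m : ℝ) (u : L2) : ℝ :=
  √(∫ ξ : R3, (‖ξ‖ ^ 2 + m ^ 2) ^ s * ‖fourier u ξ‖ ^ 2)

/-- The integrand of the nonlocal energy, as a function on `ℝ³ × ℝ³`. -/
def besselIntegrand (s m : ℝ) (u : R3 → ℂ) (p : R3 × R3) : ℝ :=
  ‖u p.1 - u p.2‖ ^ 2 / ‖p.1 - p.2‖ ^ ((3 + 2 * s) / 2) *
    besselK ((3 + 2 * s) / 2) (m * ‖p.1 - p.2‖)

/-! Elementary facts on the Fourier transform -/

theorem quasiMeasurePreserving_dilation :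
    Measure.QuasiMeasurePreserving (fun ξ : R3 => (2 * Real.pi)⁻¹ • ξ) volume volume := by
  refine ⟨by fun_prop, ?_⟩
  rw [Measure.map_addHaar_smul volume (inv_ne_zero (by positivity))]
  exact Measure.smul_absolutelyContinuous

theorem fourier_add (u v : L2) :
    fourier (u + v) =ᵐ[volume] fun ξ => fourier u ξ + fourier v ξ := by
  have h : ⇑(𝓕 (u + v) : L2) =ᵐ[volume] ⇑(𝓕 u : L2) + ⇑(𝓕 v : L2) := by
    rw [FourierTransform.fourier_add]; exact Lp.coeFn_add _ _
  filter_upwards [quasiMeasurePreserving_dilation.ae h] with ξ hξ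
  simp only [fourier]
  rw [hξ, Pi.add_apply, mul_add]

theorem fourier_smul (c : ℂ) (u : L2) :
    fourier (c • u) =ᵐ[volume] fun ξ => c * fourier u ξ := by
  have h : ⇑(𝓕 (c • u) : L2) =ᵐ[volume] c • ⇑(𝓕 u : L2) := by
    rw [FourierTransform.fourier_smul]; exact Lp.coeFn_smul _ _
  filter_upwards [quasiMeasurePreserving_dilation.ae h] with ξ hξ
  simp only [fourier]
  rw [hξ, Pi.smul_apply, smul_eq_mul, mul_left_comm]

theorem stronglyMeasurable_fourier (u : L2) : StronglyMeasurable (fourier u) :=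
  ((Lp.stronglyMeasurable (𝓕 u : L2)).comp_measurable (by fun_prop)).const_mul _

/-- The fractional Sobolev space `H^s(ℝ³, ℂ)`: all `u ∈ L²` with `|ξ|^s F u ∈ L²`. -/
def Hs (s : ℝ) : Submodule ℂ L2 where
  carrier := {u | MemLp (fun ξ : R3 => ((‖ξ‖ ^ s : ℝ) : ℂ) * fourier u ξ) 2 volume}
  zero_mem' := by
    have h := fourier_smul 0 0
    simp only [zero_smul, zero_mul] at h
    refine (MemLp.zero' (ε := ℂ) (p := 2) (μ := (volume : Measure R3))).ae_eq ?_
    filter_upwards [h] with ξ hξ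
    simp [hξ]
  add_mem' := by
    intro u v hu hv
    refine (MemLp.add hu hv).ae_eq ?_
    filter_upwards [fourier_add u v] with ξ hξ
    simp [hξ, mul_add]
  smul_mem' := by
    intro c u hu
    refine (MemLp.const_mul hu c).ae_eq ?_
    filter_upwards [fourier_smul c u] with ξ hξ
    simp [hξ, mul_left_comm]

/-! The completion `H^s_m` -/

/-- The space `C_c^∞(ℝ³, ℂ)`, to be equipped with the norm of `H^s_m` (and not with the topology
that Mathlib puts on test functions). -/
def TestHsm (s m : ℝ) (_hs : s ∈ Set.Ioo (0 : ℝ) 1) (_hm : 0 < m) : Type :=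
  𝓓((⊤ : TopologicalSpace.Opens R3), ℂ)

namespace TestHsm

variable {s m : ℝ} {hs : s ∈ Set.Ioo (0 : ℝ) 1} {hm : 0 < m}

instance : AddCommGroup (TestHsm s m hs hm) :=
  inferInstanceAs (AddCommGroup 𝓓((⊤ : TopologicalSpace.Opens R3), ℂ))

instance : Module ℂ (TestHsm s m hs hm) :=
  inferInstanceAs (Module ℂ 𝓓((⊤ : TopologicalSpace.Opens R3), ℂ))

/-- The underlying function of an element of `C_c^∞(ℝ³, ℂ)`. -/
def toFun (φ : TestHsm s m hs hm) : R3 → ℂ :=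
  TestFunction.toFun φ

theorem memLp_toFun (φ : TestHsm s m hs hm) : MemLp φ.toFun 2 volume :=
  (TestFunction.continuous φ).memLp_of_hasCompactSupport (TestFunction.hasCompactSupport φ)

/-- The class in `L²` of an element of `C_c^∞(ℝ³, ℂ)`. -/
def toL2 : TestHsm s m hs hm →ₗ[ℂ] L2 where
  toFun φ := φ.memLp_toFun.toLp φ.toFun
  map_add' φ ψ := MemLp.toLp_add φ.memLp_toFun ψ.memLp_toFun
  map_smul' c φ := MemLp.toLp_const_smul c φ.memLp_toFun

instance : Norm (TestHsm s m hs hm) := ⟨fun φ => hsmNorm s m φ.toL2⟩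

theorem norm_def (φ : TestHsm s m hs hm) :
    ‖φ‖ = √(∫ ξ : R3, (‖ξ‖ ^ 2 + m ^ 2) ^ s * ‖fourier φ.toL2 ξ‖ ^ 2) := rfl

/-- The function `(|ξ|² + m²)^(s/2) F φ(ξ)`. -/
def weighted (φ : TestHsm s m hs hm) (ξ : R3) : ℂ :=
  (((‖ξ‖ ^ 2 + m ^ 2) ^ (s / 2) : ℝ) : ℂ) * fourier φ.toL2 ξ

theorem memLp_weighted (φ : TestHsm s m hs hm) : MemLp φ.weighted 2 volume := by
  have h2 : (2 * Real.pi)⁻¹ ≠ 0 := inv_ne_zero (by positivity)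
  let f : SchwartzMap R3 ℂ :=
    (TestFunction.hasCompactSupport φ).toSchwartzMap (TestFunction.contDiff φ)
  have hf : φ.toL2 = f.toLp 2 := by
    refine Lp.ext ?_
    exact (MemLp.coeFn_toLp φ.memLp_toFun).trans (f.coeFn_toLp 2).symm
  let e : R3 ≃L[ℝ] R3 := ContinuousLinearEquiv.smulLeft (Units.mk0 _ h2)
  let g : SchwartzMap R3 ℂ := SchwartzMap.compCLMOfContinuousLinearEquiv ℂ e (𝓕 f)
  have hg : fourier φ.toL2 =ᵐ[volume]
      fun ξ => (((2 * Real.pi) ^ (-(3 / 2) : ℝ) : ℝ) : ℂ) * g ξ := by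
    have h : ⇑(𝓕 φ.toL2 : L2) =ᵐ[volume] ⇑(𝓕 f : SchwartzMap R3 ℂ) := by
      rw [hf, SchwartzMap.toLp_fourier_eq]
      exact (𝓕 f : SchwartzMap R3 ℂ).coeFn_toLp 2
    filter_upwards [quasiMeasurePreserving_dilation.ae h] with ξ hξ
    simp only [fourier]
    rw [hξ]
    rfl
  let w : R3 → ℂ := fun ξ => ((‖ξ‖ ^ 2 + m ^ 2 + 1 : ℝ) : ℂ)
  have hw : w.HasTemperateGrowth := by
    have : Function.HasTemperateGrowth (fun ξ : R3 => ‖ξ‖ ^ 2 + m ^ 2 + 1) := by fun_prop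
    exact (Complex.ofRealCLM.hasTemperateGrowth).comp this
  have key : MemLp (fun ξ => (((2 * Real.pi) ^ (-(3 / 2) : ℝ) : ℝ) : ℂ) * (w ξ * g ξ)) 2
      (volume : Measure R3) := by
    refine MemLp.const_mul ?_ _
    refine ((SchwartzMap.smulLeftCLM ℂ w g).memLp 2).ae_eq (.of_forall fun ξ => ?_)
    simp [SchwartzMap.smulLeftCLM_apply_apply hw]
  refine key.mono ?_ ?_
  · refine AEStronglyMeasurable.mul ?_ (stronglyMeasurable_fourier _).aestronglyMeasurable
    exact (Measurable.aestronglyMeasurable (by fun_prop))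
  · filter_upwards [hg] with ξ hξ
    have hm2 : 0 < ‖ξ‖ ^ 2 + m ^ 2 := by have := hm; positivity
    have hle : (‖ξ‖ ^ 2 + m ^ 2) ^ (s / 2) ≤ ‖ξ‖ ^ 2 + m ^ 2 + 1 := by
      calc (‖ξ‖ ^ 2 + m ^ 2) ^ (s / 2) ≤ (‖ξ‖ ^ 2 + m ^ 2 + 1) ^ (s / 2) := by
            have := hs.1
            exact Real.rpow_le_rpow hm2.le (by linarith) (by linarith)
        _ ≤ (‖ξ‖ ^ 2 + m ^ 2 + 1) ^ (1 : ℝ) := by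
            have := hs.2
            exact Real.rpow_le_rpow_of_exponent_le (by linarith) (by linarith)
        _ = _ := Real.rpow_one _
    have hw' : ‖w ξ‖ = ‖ξ‖ ^ 2 + m ^ 2 + 1 := by
      simp only [w]
      rw [Complex.norm_real, Real.norm_of_nonneg (by linarith)]
    have hp : ‖(((‖ξ‖ ^ 2 + m ^ 2) ^ (s / 2) : ℝ) : ℂ)‖ = (‖ξ‖ ^ 2 + m ^ 2) ^ (s / 2) := by
      rw [Complex.norm_real, Real.norm_of_nonneg (by positivity)]
    simp only [weighted]
    rw [hξ, mul_left_comm, norm_mul, norm_mul, norm_mul _ (w ξ * g ξ), norm_mul (w ξ), hw', hp]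
    gcongr

theorem norm_eq (φ : TestHsm s m hs hm) : ‖φ‖ = ‖φ.memLp_weighted.toLp φ.weighted‖ := by
  rw [Lp.norm_toLp, φ.memLp_weighted.eLpNorm_eq_integral_rpow_norm (by simp) (by simp),
    ENNReal.toReal_ofReal (by positivity), norm_def, Real.sqrt_eq_rpow]
  simp only [ENNReal.toReal_ofNat, Real.rpow_ofNat, one_div]
  congr 2
  funext ξ
  have hm2 : 0 ≤ ‖ξ‖ ^ 2 + m ^ 2 := by positivity
  rw [weighted, norm_mul, mul_pow, Complex.norm_real, Real.norm_of_nonneg (by positivity),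
    ← Real.rpow_natCast (_ ^ (s / 2)), ← Real.rpow_mul hm2]
  congr 2
  push_cast
  ring

theorem core : SeminormedSpace.Core ℂ (TestHsm s m hs hm) where
  norm_nonneg φ := Real.sqrt_nonneg _
  norm_smul c φ := by
    rw [norm_eq, norm_eq, ← norm_smul, ← MemLp.toLp_const_smul]
    congr 1
    refine (MemLp.toLp_eq_toLp_iff _ _).2 ?_
    filter_upwards [fourier_smul c φ.toL2] with ξ hξ
    simp only [weighted, map_smul, hξ, Pi.smul_apply, smul_eq_mul]
    ring
  norm_triangle φ ψ := by
    rw [norm_eq, norm_eq φ, norm_eq ψ]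
    refine le_trans (le_of_eq ?_) (norm_add_le _ _)
    rw [← MemLp.toLp_add]
    congr 1
    refine (MemLp.toLp_eq_toLp_iff _ _).2 ?_
    filter_upwards [fourier_add φ.toL2 ψ.toL2] with ξ hξ
    simp only [weighted, map_add, hξ, Pi.add_apply]
    ring

instance : SeminormedAddCommGroup (TestHsm s m hs hm) := SeminormedAddCommGroup.ofCore core

instance : NormedSpace ℂ (TestHsm s m hs hm) := ⟨fun c φ => (core.norm_smul c φ).le⟩

end TestHsm

/-- The space `H^s_m(ℝ³, ℂ)`: the completion of `C_c^∞(ℝ³, ℂ)` with respect to the norm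
`(∫ (|ξ|² + m²)^s |F φ(ξ)|² dξ)^(1/2)`. -/
abbrev Hsm (s m : ℝ) (hs : s ∈ Set.Ioo (0 : ℝ) 1) (hm : 0 < m) : Type :=
  UniformSpace.Completion (TestHsm s m hs hm)

end PseudoRel

end

namespace PseudoRel

/-! ### Multiplication operators on `L²` and the Sobolev weight -/

section

open scoped ComplexConjugate Convolution ContDiff

/-! Both spaces are compared with `L²` through `u ↦ w 𝓕u`, where `w(η) = (|2πη|² + m²)^(s/2)`. On
test functions this is an isometry for the `H^s_m` norm with dense range
(`TestHsm.denseRange_weightedFourier`), so it extends to an isometric isomorphism of the completion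
onto `L²`. On `H^s` the same formula is a bijection onto `L²`, because `w ≥ m^s > 0` makes division
by `w` bounded (`bijective_weightedFourierHs`). Composing one with the inverse of the other gives
`J`. The equivalence of norms is the pointwise bound `(a + b)^s ≤ a^s + b^s ≤ 2 (a + b)^s` for `a, b
≥ 0`.

For the Bessel formula, put `z = x - y` and apply Plancherel in `x`: the double integral becomes the
integral of `|𝓕u(η)|²` against the symbol `∫ |exp(-2πi z·η) - 1|² k(z) dz`, where `k` is
`besselKernel`. Since `k` is a superposition of Gaussians, this symbol reduces to a Gaussian Fourier
transform and a Gamma integral, and equals `(|2πη|² + m²)^s - m^(2s)`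
(`lintegral_phaseSq_mul_besselKernel`). The subtracted `m^(2s)` is returned by the `L²` term. These
exchanges are made by Tonelli on `[0, ∞]`-valued integrals, so finiteness of the double integral is
a consequence and not a prerequisite. -/

theorem memLp_bounded_mul {b : R3 → ℂ} (hb : AEStronglyMeasurable b volume) {C : ℝ}
    (hC : ∀ x, ‖b x‖ ≤ C) (g : L2) : MemLp (fun x => b x * g x) 2 volume :=
  (Lp.memLp g).of_le_mul (hb.mul (Lp.aestronglyMeasurable g)) (c := C)
    (.of_forall fun x => by
      rw [norm_mul]; exact mul_le_mul_of_nonneg_right (hC x) (norm_nonneg _))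

/-- Multiplication by a bounded function, as an operator on `L²`. -/
noncomputable def mulL2 (b : R3 → ℂ) (hb : AEStronglyMeasurable b volume) (C : ℝ)
    (hC : ∀ x, ‖b x‖ ≤ C) : L2 →L[ℂ] L2 :=
  LinearMap.mkContinuous
    { toFun g := (memLp_bounded_mul hb hC g).toLp _
      map_add' g h := by
        rw [← MemLp.toLp_add]
        refine (MemLp.toLp_eq_toLp_iff _ _).2 ?_
        filter_upwards [Lp.coeFn_add g h] with x hx
        rw [Pi.add_apply, hx, Pi.add_apply, mul_add]
      map_smul' c g := by
        rw [RingHom.id_apply, ← MemLp.toLp_const_smul]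
        refine (MemLp.toLp_eq_toLp_iff _ _).2 ?_
        filter_upwards [Lp.coeFn_smul c g] with x hx
        simp only [hx, Pi.smul_apply, smul_eq_mul]
        ring }
    C (fun g => by
      refine Lp.norm_le_mul_norm_of_ae_le_mul ?_
      filter_upwards [(memLp_bounded_mul hb hC g).coeFn_toLp] with x hx
      simp only [LinearMap.coe_mk, AddHom.coe_mk]
      rw [hx, norm_mul]
      exact mul_le_mul_of_nonneg_right (hC x) (norm_nonneg _))

theorem coeFn_mulL2 (b : R3 → ℂ) (hb : AEStronglyMeasurable b volume) (C : ℝ)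
    (hC : ∀ x, ‖b x‖ ≤ C) (g : L2) : mulL2 b hb C hC g =ᵐ[volume] fun x => b x * g x :=
  MemLp.coeFn_toLp (memLp_bounded_mul hb hC g)

/-- The weight `(|2πη|² + m²)^(s/2)`. -/
noncomputable def weight (s m : ℝ) (η : R3) : ℝ := (‖(2 * Real.pi) • η‖ ^ 2 + m ^ 2) ^ (s / 2)

theorem measurable_weight (s m : ℝ) : Measurable (weight s m) := by
  unfold weight; fun_prop

theorem weight_pos {m : ℝ} (hm : 0 < m) (s : ℝ) (η : R3) : 0 < weight s m η :=
  Real.rpow_pos_of_pos (by positivity) _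

theorem weight_le {s m : ℝ} (hs : s ∈ Set.Ioo (0 : ℝ) 1) (η : R3) :
    weight s m η ≤ (2 * Real.pi) ^ 2 * ‖η‖ ^ 2 + (m ^ 2 + 1) := by
  have h0 : 0 ≤ ‖(2 * Real.pi) • η‖ ^ 2 + m ^ 2 := by positivity
  have := hs.1
  have := hs.2
  -- Adding 1 makes the base at least 1, so the exponent `s / 2` can be raised to 1.
  calc weight s m η ≤ (‖(2 * Real.pi) • η‖ ^ 2 + m ^ 2 + 1) ^ (s / 2) :=
        Real.rpow_le_rpow h0 (by linarith) (by linarith)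
    _ ≤ (‖(2 * Real.pi) • η‖ ^ 2 + m ^ 2 + 1) ^ (1 : ℝ) :=
        Real.rpow_le_rpow_of_exponent_le (by linarith) (by linarith)
    _ = _ := by
        rw [Real.rpow_one, norm_smul, mul_pow, Real.norm_of_nonneg (by positivity)]; ring

/-- Makes the reciprocal of the weight a bounded multiplier, as surjectivity onto `L²` requires. -/
theorem le_weight {s m : ℝ} (hs : s ∈ Set.Ioo (0 : ℝ) 1) (hm : 0 < m) (η : R3) :
    m ^ s ≤ weight s m η := by
  have := hs.1
  calc m ^ s = (m ^ 2) ^ (s / 2) := by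
        rw [← Real.rpow_natCast, ← Real.rpow_mul hm.le]; congr 1; push_cast; ring
    _ ≤ _ := Real.rpow_le_rpow (by positivity) (by nlinarith [sq_nonneg ‖(2 * Real.pi) • η‖])
        (by linarith)

theorem weight_sq {m : ℝ} (s : ℝ) (η : R3) :
    weight s m η ^ 2 = (‖(2 * Real.pi) • η‖ ^ 2 + m ^ 2) ^ s := by
  rw [weight, ← Real.rpow_natCast, ← Real.rpow_mul (by positivity)]
  congr 1; push_cast; ring

theorem exists_weight_mul_schwartz_le {s m : ℝ} (hs : s ∈ Set.Ioo (0 : ℝ) 1)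
    (f : SchwartzMap R3 ℂ) : ∃ C, ∀ η, ‖(weight s m η : ℂ) * f η‖ ≤ C := by
  obtain ⟨A, -, hA⟩ := f.decay 2 0
  obtain ⟨B, -, hB⟩ := f.decay 0 0
  refine ⟨(2 * Real.pi) ^ 2 * A + (m ^ 2 + 1) * B, fun η => ?_⟩
  have h1 := hA η
  have h2 := hB η
  simp only [norm_iteratedFDeriv_zero, pow_zero, one_mul] at h1 h2
  have h0 : 0 ≤ weight s m η := Real.rpow_nonneg (by positivity) _
  rw [norm_mul, Complex.norm_real, Real.norm_of_nonneg h0]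
  calc _ ≤ ((2 * Real.pi) ^ 2 * ‖η‖ ^ 2 + (m ^ 2 + 1)) * ‖f η‖ := by
        gcongr; exact weight_le hs η
    _ = (2 * Real.pi) ^ 2 * (‖η‖ ^ 2 * ‖f η‖) + (m ^ 2 + 1) * ‖f η‖ := by ring
    _ ≤ _ := by gcongr

/-! Change of variables between the two normalizations of the Fourier transform -/

theorem fourier_two_pi_smul (u : L2) (η : R3) :
    fourier u ((2 * Real.pi) • η) =
      (((2 * Real.pi) ^ (-(3 / 2) : ℝ) : ℝ) : ℂ) * (𝓕 u : L2) η := by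
  rw [fourier, inv_smul_smul₀ (by positivity)]

theorem norm_fourier_two_pi_smul_sq (u : L2) (η : R3) :
    ‖fourier u ((2 * Real.pi) • η)‖ ^ 2 = ((2 * Real.pi) ^ 3)⁻¹ * ‖(𝓕 u : L2) η‖ ^ 2 := by
  rw [fourier_two_pi_smul, norm_mul, mul_pow, Complex.norm_real,
    Real.norm_of_nonneg (by positivity), ← Real.rpow_natCast, ← Real.rpow_mul (by positivity)]
  norm_num [Real.rpow_neg, Real.pi_pos.le]

/-- The dilation by `2π` only brings in the nonzero constant `(2π)^(-3)`. For the integrals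
themselves, in `integral_mul_fourier`, the Jacobian cancels this constant exactly. -/
theorem integrable_mul_fourier_iff (ψ : R3 → ℝ) (u : L2) :
    Integrable (fun ξ => ψ ξ * ‖fourier u ξ‖ ^ 2) volume ↔
      Integrable (fun η => ψ ((2 * Real.pi) • η) * ‖(𝓕 u : L2) η‖ ^ 2) volume := by
  rw [← MeasureTheory.integrable_comp_smul_iff (volume : Measure R3) _ (R := 2 * Real.pi)
    (by positivity)]
  simp_rw [norm_fourier_two_pi_smul_sq, mul_left_comm _ (((2 * Real.pi) ^ 3)⁻¹)]
  exact integrable_const_mul_iff (IsUnit.mk0 _ (by positivity)) _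

theorem integral_mul_fourier (ψ : R3 → ℝ) (u : L2) :
    ∫ ξ, ψ ξ * ‖fourier u ξ‖ ^ 2 = ∫ η, ψ ((2 * Real.pi) • η) * ‖(𝓕 u : L2) η‖ ^ 2 := by
  have h := Measure.integral_comp_smul (volume : Measure R3)
    (fun ξ => ψ ξ * ‖fourier u ξ‖ ^ 2) (2 * Real.pi)
  simp_rw [norm_fourier_two_pi_smul_sq, mul_left_comm _ (((2 * Real.pi) ^ 3)⁻¹)] at h
  rw [integral_const_mul, finrank_euclideanSpace_fin, abs_of_pos (by positivity),
    smul_eq_mul] at h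
  exact (mul_left_cancel₀ (by positivity) h).symm

theorem memLp_weight_mul_iff (s m : ℝ) (u : L2) :
    MemLp (fun η => (weight s m η : ℂ) * (𝓕 u : L2) η) 2 volume ↔
      Integrable (fun ξ => (‖ξ‖ ^ 2 + m ^ 2) ^ s * ‖fourier u ξ‖ ^ 2) volume := by
  have hmeas : AEStronglyMeasurable (fun η => (weight s m η : ℂ) * (𝓕 u : L2) η) volume :=
    (Complex.measurable_ofReal.comp (measurable_weight s m)).aestronglyMeasurable.mul
      (Lp.aestronglyMeasurable _)
  rw [integrable_mul_fourier_iff (fun ξ => (‖ξ‖ ^ 2 + m ^ 2) ^ s),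
    memLp_two_iff_integrable_sq_norm hmeas]
  simp_rw [norm_mul, mul_pow, Complex.norm_real, Real.norm_eq_abs, sq_abs, weight_sq]

theorem norm_toLp_weight_mul {s m : ℝ} (u : L2)
    (h : MemLp (fun η => (weight s m η : ℂ) * (𝓕 u : L2) η) 2 volume) :
    ‖h.toLp _‖ = hsmNorm s m u := by
  rw [hsmNorm, integral_mul_fourier (fun ξ => (‖ξ‖ ^ 2 + m ^ 2) ^ s), Lp.norm_toLp,
    h.eLpNorm_eq_integral_rpow_norm (by simp) (by simp),
    ENNReal.toReal_ofReal (by positivity), Real.sqrt_eq_rpow]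
  simp only [ENNReal.toReal_ofNat, Real.rpow_ofNat, one_div]
  congr 2
  funext η
  rw [norm_mul, mul_pow, Complex.norm_real, Real.norm_eq_abs, sq_abs, weight_sq]

/-! ### Density of the weighted transforms of test functions -/

namespace TestHsm

variable {s m : ℝ} {hs : s ∈ Set.Ioo (0 : ℝ) 1} {hm : 0 < m}

/-- The Schwartz function underlying an element of `C_c^∞`. -/
noncomputable def toSchwartz (φ : TestHsm s m hs hm) : SchwartzMap R3 ℂ :=
  (TestFunction.hasCompactSupport φ).toSchwartzMap (TestFunction.contDiff φ)

theorem coe_toSchwartz (φ : TestHsm s m hs hm) : ⇑φ.toSchwartz = φ.toFun := rfl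

theorem toL2_eq (φ : TestHsm s m hs hm) : φ.toL2 = φ.toSchwartz.toLp 2 := by
  refine Lp.ext ?_
  exact (MemLp.coeFn_toLp φ.memLp_toFun).trans (φ.toSchwartz.coeFn_toLp 2).symm

theorem coeFn_fourier_toL2 (φ : TestHsm s m hs hm) :
    ⇑(𝓕 φ.toL2 : L2) =ᵐ[volume] ⇑(𝓕 φ.toSchwartz : SchwartzMap R3 ℂ) := by
  rw [toL2_eq, SchwartzMap.toLp_fourier_eq]
  exact SchwartzMap.coeFn_toLp (𝓕 φ.toSchwartz) 2 volume

/-- The element of `C_c^∞` with a given underlying function. -/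
def mk (f : R3 → ℂ) (hf : HasCompactSupport f) (hf' : ContDiff ℝ ∞ f) : TestHsm s m hs hm :=
  (⟨f, hf', hf, fun _ _ => trivial⟩ : 𝓓((⊤ : TopologicalSpace.Opens R3), ℂ))

theorem denseRange_toL2 : DenseRange (toL2 : TestHsm s m hs hm →ₗ[ℂ] L2) := by
  intro f
  refine (mem_closure_iff_nhds_basis Metric.nhds_basis_closedBall).2 fun (ε : ℝ) hε => ?_
  obtain ⟨g, hg₁, hg₂, hg₃⟩ := MemLp.exist_eLpNorm_sub_le (μ := (volume : Measure R3))
    ENNReal.ofNat_ne_top (Fact.out : (1 : ENNReal) ≤ 2) (Lp.memLp f) hε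
  refine ⟨toL2 (mk g hg₁ hg₂), ⟨_, rfl⟩, ?_⟩
  have : (f : R3 → ℂ) - ((mk g hg₁ hg₂ : TestHsm s m hs hm).toL2 : R3 → ℂ) =ᵐ[volume]
      (f : R3 → ℂ) - g := by
    filter_upwards [MemLp.coeFn_toLp (mk g hg₁ hg₂ : TestHsm s m hs hm).memLp_toFun] with x hx
    simp only [Pi.sub_apply]
    congr 1
  rw [Metric.mem_closedBall', Lp.dist_def, eLpNorm_congr_ae this]
  grw [hg₃, ENNReal.toReal_ofReal hε.le]
  simp

/-- By Plancherel the hypothesis says that `𝓕⁻ g` is orthogonal to the test functions, which are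
dense in `L²`. -/
theorem eq_zero_of_inner_fourier_toL2 (g : L2)
    (h : ∀ φ : TestHsm s m hs hm, inner ℂ (𝓕 φ.toL2 : L2) g = 0) : g = 0 := by
  have h2 : ∀ u : L2, inner ℂ u (𝓕⁻ g : L2) = 0 := by
    refine isClosed_property (denseRange_toL2 (hs := hs) (hm := hm))
      (isClosed_eq (by fun_prop) (by fun_prop)) ?_
    · exact fun φ => by
        rw [← Lp.inner_fourier_eq, FourierTransform.fourier_fourierInv_eq]; exact h φ
  have h3 : (𝓕⁻ g : L2) = 0 := inner_self_eq_zero.1 (h2 _)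
  rw [← FourierTransform.fourier_fourierInv_eq (F := L2) g, h3]
  exact (Lp.fourierTransformₗᵢ R3 ℂ).map_zero

/-- Convolution keeps smoothness and compact support and turns into a product under the Fourier
transform. -/
theorem exists_fourier_mul (f ρ : TestHsm s m hs hm) :
    ∃ χ : TestHsm s m hs hm, ∀ η, (𝓕 χ.toSchwartz : SchwartzMap R3 ℂ) η =
      (𝓕 ρ.toSchwartz : SchwartzMap R3 ℂ) η * (𝓕 f.toSchwartz : SchwartzMap R3 ℂ) η := by
  refine ⟨mk (ρ.toSchwartz ⋆[ContinuousLinearMap.mul ℂ ℂ] f.toSchwartz) ?_ ?_, fun η => ?_⟩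
  · exact HasCompactSupport.convolution _ (TestFunction.hasCompactSupport ρ)
      (TestFunction.hasCompactSupport f)
  · exact HasCompactSupport.contDiff_convolution_right (ContinuousLinearMap.mul ℝ ℂ)
      (TestFunction.hasCompactSupport f)
      (ρ.toSchwartz.integrable (μ := volume)).locallyIntegrable (f.toSchwartz.smooth ⊤)
  · rw [SchwartzMap.fourier_coe, coe_toSchwartz]
    exact Real.fourier_mul_convolution_eq (ρ.toSchwartz.integrable) (f.toSchwartz.integrable) η

theorem memLp_weight_mul (φ : TestHsm s m hs hm) :
    MemLp (fun η => (weight s m η : ℂ) * (𝓕 φ.toL2 : L2) η) 2 volume := by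
  refine (memLp_weight_mul_iff s m φ.toL2).2 ?_
  have h := (memLp_two_iff_integrable_sq_norm φ.memLp_weighted.1).1 φ.memLp_weighted
  refine h.congr (.of_forall fun ξ => ?_)
  have hm2 : 0 ≤ ‖ξ‖ ^ 2 + m ^ 2 := by positivity
  simp only [weighted]
  rw [norm_mul, mul_pow, Complex.norm_real, Real.norm_of_nonneg (by positivity),
    ← Real.rpow_natCast (_ ^ (s / 2)), ← Real.rpow_mul hm2]
  congr 2
  push_cast
  ring

/-- The isometry `φ ↦ (|2πη|² + m²)^(s/2) 𝓕 φ` of `C_c^∞` with the norm of `H^s_m` into `L²`. -/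
noncomputable def weightedFourier : TestHsm s m hs hm →ₗᵢ[ℂ] L2 where
  toFun φ := φ.memLp_weight_mul.toLp _
  map_add' φ ψ := by
    rw [← MemLp.toLp_add]
    refine (MemLp.toLp_eq_toLp_iff _ _).2 ?_
    rw [map_add, FourierTransform.fourier_add]
    filter_upwards [Lp.coeFn_add (𝓕 φ.toL2 : L2) (𝓕 ψ.toL2)] with x hx
    rw [Pi.add_apply, hx, Pi.add_apply, mul_add]
  map_smul' c φ := by
    rw [RingHom.id_apply, ← MemLp.toLp_const_smul]
    refine (MemLp.toLp_eq_toLp_iff _ _).2 ?_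
    rw [map_smul, FourierTransform.fourier_smul]
    filter_upwards [Lp.coeFn_smul c (𝓕 φ.toL2 : L2)] with x hx
    simp only [hx, Pi.smul_apply, smul_eq_mul]
    ring
  norm_map' φ := by
    change ‖φ.memLp_weight_mul.toLp _‖ = hsmNorm s m φ.toL2
    exact norm_toLp_weight_mul _ _

theorem coeFn_weightedFourier (φ : TestHsm s m hs hm) :
    weightedFourier φ =ᵐ[volume] fun η => (weight s m η : ℂ) * (𝓕 φ.toL2 : L2) η :=
  MemLp.coeFn_toLp φ.memLp_weight_mul

/-- If `g` is orthogonal to the range, test it against convolutions `ρ ⋆ f`. The factor `w 𝓕ρ` is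
bounded and can be moved onto `g`, while `𝓕f` is left free; this forces `g` times the conjugate of
`w 𝓕ρ` to vanish for every `ρ`. Convolving avoids having to divide a test function's transform by
`w`, which need not give the transform of a test function. -/
theorem denseRange_weightedFourier :
    DenseRange (weightedFourier : TestHsm s m hs hm →ₗᵢ[ℂ] L2) := by
  have key : (LinearMap.range
      (weightedFourier : TestHsm s m hs hm →ₗᵢ[ℂ] L2).toLinearMap)ᗮ = ⊥ := by
    rw [eq_bot_iff]
    intro g hg
    have hg' : ∀ φ : TestHsm s m hs hm, inner ℂ (weightedFourier φ) g = 0 :=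
      fun φ => (Submodule.mem_orthogonal _ _).1 hg _ ⟨φ, rfl⟩
    rw [Submodule.mem_bot]
    refine eq_zero_of_inner_fourier_toL2 (hs := hs) (hm := hm) g fun ρ => ?_
    obtain ⟨C, hC⟩ := exists_weight_mul_schwartz_le (m := m) hs (𝓕 ρ.toSchwartz)
    set b : R3 → ℂ := fun η => conj ((weight s m η : ℂ) * 𝓕 ρ.toSchwartz η) with hb_def
    have hb : AEStronglyMeasurable b volume := by
      refine Measurable.aestronglyMeasurable ?_
      have h1 := measurable_weight s m
      have h2 : Measurable (𝓕 ρ.toSchwartz : SchwartzMap R3 ℂ) :=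
        (SchwartzMap.continuous _).measurable
      have h3 : Measurable fun z : ℂ => conj z := Complex.continuous_conj.measurable
      exact h3.comp ((Complex.measurable_ofReal.comp h1).mul h2)
    have hbC : ∀ η, ‖b η‖ ≤ C := fun η => by
      rw [hb_def, RCLike.norm_conj]; exact hC η
    -- The pairing of `𝓕f` with `b g` is the pairing of `w 𝓕(ρ ⋆ f)` with `g`, which is zero.
    have h0 : mulL2 b hb C hbC g = 0 := by
      refine eq_zero_of_inner_fourier_toL2 (hs := hs) (hm := hm) _ fun f => ?_
      obtain ⟨χ, hχ⟩ := exists_fourier_mul f ρ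
      rw [← hg' χ, L2.inner_def, L2.inner_def]
      refine integral_congr_ae ?_
      filter_upwards [coeFn_mulL2 b hb C hbC g, coeFn_weightedFourier χ,
        χ.coeFn_fourier_toL2, f.coeFn_fourier_toL2] with η h1 h2 h3 h4
      rw [h1, h2, h3, h4, hχ, RCLike.inner_apply, RCLike.inner_apply, hb_def]
      simp only [map_mul]
      ring
    rw [L2.inner_def]
    refine integral_eq_zero_of_ae ?_
    have h1 := coeFn_mulL2 b hb C hbC g
    rw [h0] at h1
    filter_upwards [h1, Lp.coeFn_zero ℂ 2 (volume : Measure R3), ρ.coeFn_fourier_toL2]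
      with η h1 h2 h3
    rw [h2, Pi.zero_apply, hb_def] at h1
    simp only at h1
    rw [map_mul, Complex.conj_ofReal, mul_assoc, eq_comm,
      mul_eq_zero] at h1
    rw [h3, RCLike.inner_apply, Pi.zero_apply, mul_comm]
    -- The weight never vanishes, so `g` times the conjugate of `𝓕ρ` is zero almost everywhere.
    exact h1.resolve_left (Complex.ofReal_ne_zero.2 (weight_pos hm s η).ne')
  have := Submodule.topologicalClosure_eq_top_iff.2 key
  exact Submodule.dense_iff_topologicalClosure_eq_top.2 this

end TestHsm

/-! ### Extension to the completion -/

section Extension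

variable {s m : ℝ} (hs : s ∈ Set.Ioo (0 : ℝ) 1) (hm : 0 < m)

/-- The extension of `TestHsm.weightedFourier` to the completion. -/
noncomputable def weightedFourierHsm : Hsm s m hs hm ≃ₗᵢ[ℂ] L2 :=
  (LinearEquiv.refl ℂ (TestHsm s m hs hm)).extendOfIsometry
    (UniformSpace.Completion.toComplₗᵢ (𝕜 := ℂ) (E := TestHsm s m hs hm)).toLinearMap
    (TestHsm.weightedFourier (hs := hs) (hm := hm)).toLinearMap
    UniformSpace.Completion.denseRange_coe TestHsm.denseRange_weightedFourier
    (fun φ => by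
      change ‖TestHsm.weightedFourier φ‖ = ‖(φ : Hsm s m hs hm)‖
      rw [LinearIsometry.norm_map, UniformSpace.Completion.norm_coe])

theorem weightedFourierHsm_coe (φ : TestHsm s m hs hm) :
    weightedFourierHsm hs hm (φ : Hsm s m hs hm) = TestHsm.weightedFourier φ :=
  LinearEquiv.extendOfIsometry_eq _ _ _ _ _ _ φ

end Extension

end

/-! ### Integral description of `H^s` and comparison of the norms -/

theorem mem_Hs_iff {s : ℝ} (u : L2) :
    u ∈ Hs s ↔ Integrable (fun ξ => ‖ξ‖ ^ (2 * s) * ‖fourier u ξ‖ ^ 2) volume := by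
  have hmeas : AEStronglyMeasurable (fun ξ : R3 => ((‖ξ‖ ^ s : ℝ) : ℂ) * fourier u ξ) volume :=
    (Complex.measurable_ofReal.comp
      (by fun_prop : Measurable fun ξ : R3 => ‖ξ‖ ^ s)).aestronglyMeasurable.mul
      (stronglyMeasurable_fourier u).aestronglyMeasurable
  change MemLp (fun ξ : R3 => ((‖ξ‖ ^ s : ℝ) : ℂ) * fourier u ξ) 2 volume ↔ _
  rw [memLp_two_iff_integrable_sq_norm hmeas]
  refine integrable_congr (.of_forall fun ξ => ?_)
  simp only [norm_mul, mul_pow, Complex.norm_real, Real.norm_eq_abs, sq_abs]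
  rw [← Real.rpow_natCast (‖ξ‖ ^ s), ← Real.rpow_mul (norm_nonneg _), mul_comm s]
  norm_num

theorem integrable_norm_fourier_sq (u : L2) : Integrable (fun ξ => ‖fourier u ξ‖ ^ 2) volume := by
  have h := (integrable_mul_fourier_iff (fun _ => 1) u).2 (by
    simpa using (memLp_two_iff_integrable_sq_norm (Lp.aestronglyMeasurable _)).1
      (Lp.memLp (𝓕 u : L2)))
  simpa using h

/-- Subadditivity of `t ↦ t^s` on `[0, ∞)` for `0 ≤ s ≤ 1`. -/
theorem rpow_norm_add_le {s m : ℝ} (hs : s ∈ Set.Ioo (0 : ℝ) 1) (hm : 0 < m) (r : ℝ) (hr : 0 ≤ r) :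
    (r ^ 2 + m ^ 2) ^ s ≤ r ^ (2 * s) + m ^ (2 * s) := by
  rw [Real.rpow_mul hr, Real.rpow_mul hm.le, Real.rpow_two, Real.rpow_two]
  exact Real.rpow_add_le_add_rpow (by positivity) (by positivity) hs.1.le hs.2.le

/-- Each of the two terms is at most `(r² + m²)^s` by monotonicity, hence the factor 2. -/
theorem rpow_add_rpow_le {s m : ℝ} (hs : s ∈ Set.Ioo (0 : ℝ) 1) (hm : 0 < m) (r : ℝ) (hr : 0 ≤ r) :
    r ^ (2 * s) + m ^ (2 * s) ≤ 2 * (r ^ 2 + m ^ 2) ^ s := by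
  rw [Real.rpow_mul hr, Real.rpow_mul hm.le, Real.rpow_two, Real.rpow_two]
  have h1 : (r ^ 2) ^ s ≤ (r ^ 2 + m ^ 2) ^ s :=
    Real.rpow_le_rpow (by positivity) (by nlinarith) hs.1.le
  have h2 : (m ^ 2) ^ s ≤ (r ^ 2 + m ^ 2) ^ s :=
    Real.rpow_le_rpow (by positivity) (by nlinarith) hs.1.le
  linarith

theorem aestronglyMeasurable_mul_fourier {ψ : R3 → ℝ} (hψ : Measurable ψ) (u : L2) :
    AEStronglyMeasurable (fun ξ => ψ ξ * ‖fourier u ξ‖ ^ 2) volume :=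
  hψ.aestronglyMeasurable.mul ((stronglyMeasurable_fourier u).norm.pow 2).aestronglyMeasurable

section

variable {s m : ℝ}

theorem mem_Hs_iff_integrable (hs : s ∈ Set.Ioo (0 : ℝ) 1) (hm : 0 < m) (u : L2) :
    u ∈ Hs s ↔
      Integrable (fun ξ => (‖ξ‖ ^ 2 + m ^ 2) ^ s * ‖fourier u ξ‖ ^ 2) volume := by
  rw [mem_Hs_iff]
  refine ⟨fun h => ?_, fun h => ?_⟩
  · refine (h.add ((integrable_norm_fourier_sq u).const_mul (m ^ (2 * s)))).mono'
      (aestronglyMeasurable_mul_fourier (by fun_prop) u) (.of_forall fun ξ => ?_)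
    rw [Real.norm_of_nonneg (by positivity), Pi.add_apply, ← add_mul]
    exact mul_le_mul_of_nonneg_right (rpow_norm_add_le hs hm _ (norm_nonneg _)) (by positivity)
  · refine (h.const_mul 2).mono'
      (aestronglyMeasurable_mul_fourier (by fun_prop) u) (.of_forall fun ξ => ?_)
    rw [Real.norm_of_nonneg (by positivity), ← mul_assoc]
    refine mul_le_mul_of_nonneg_right ?_ (by positivity)
    have := rpow_add_rpow_le hs hm _ (norm_nonneg ξ)
    have : 0 < m ^ (2 * s) := Real.rpow_pos_of_pos hm _
    linarith

theorem hsmNorm_le_hsNorm (hs : s ∈ Set.Ioo (0 : ℝ) 1) (hm : 0 < m) (u : Hs s) :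
    hsmNorm s m u ≤ hsNorm s m u := by
  refine Real.sqrt_le_sqrt (integral_mono ((mem_Hs_iff_integrable hs hm _).1 u.2) ?_ fun ξ => ?_)
  · simp_rw [add_mul]
    exact ((mem_Hs_iff _).1 u.2).add ((integrable_norm_fourier_sq _).const_mul _)
  · exact mul_le_mul_of_nonneg_right (rpow_norm_add_le hs hm _ (norm_nonneg _)) (by positivity)

theorem hsNorm_le_hsmNorm (hs : s ∈ Set.Ioo (0 : ℝ) 1) (hm : 0 < m) (u : Hs s) :
    hsNorm s m u ≤ √2 * hsmNorm s m u := by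
  rw [hsmNorm, ← Real.sqrt_mul (by norm_num), ← integral_const_mul]
  refine Real.sqrt_le_sqrt (integral_mono ?_
    (((mem_Hs_iff_integrable hs hm _).1 u.2).const_mul 2) fun ξ => ?_)
  · simp_rw [add_mul]
    exact ((mem_Hs_iff _).1 u.2).add ((integrable_norm_fourier_sq _).const_mul _)
  · simp only [← mul_assoc]
    exact mul_le_mul_of_nonneg_right (rpow_add_rpow_le hs hm _ (norm_nonneg _)) (by positivity)

/-! ### Identification of the completion with `H^s` -/

theorem memLp_weight_mul_of_mem (hs : s ∈ Set.Ioo (0 : ℝ) 1) (hm : 0 < m) (u : Hs s) :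
    MemLp (fun η => (weight s m η : ℂ) * (𝓕 (u : L2) : L2) η) 2 volume :=
  (memLp_weight_mul_iff s m u).2 ((mem_Hs_iff_integrable hs hm _).1 u.2)

/-- The linear map `u ↦ (|2πη|² + m²)^(s/2) 𝓕 u` of `H^s` into `L²`. -/
noncomputable def weightedFourierHs (hs : s ∈ Set.Ioo (0 : ℝ) 1) (hm : 0 < m) :
    Hs s →ₗ[ℂ] L2 where
  toFun u := (memLp_weight_mul_of_mem hs hm u).toLp _
  map_add' u v := by
    rw [← MemLp.toLp_add]
    refine (MemLp.toLp_eq_toLp_iff _ _).2 ?_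
    rw [Submodule.coe_add, FourierTransform.fourier_add]
    filter_upwards [Lp.coeFn_add (𝓕 (u : L2) : L2) (𝓕 (v : L2))] with x hx
    rw [Pi.add_apply, hx, Pi.add_apply, mul_add]
  map_smul' c u := by
    rw [RingHom.id_apply, ← MemLp.toLp_const_smul]
    refine (MemLp.toLp_eq_toLp_iff _ _).2 ?_
    rw [Submodule.coe_smul, FourierTransform.fourier_smul]
    filter_upwards [Lp.coeFn_smul c (𝓕 (u : L2) : L2)] with x hx
    simp only [hx, Pi.smul_apply, smul_eq_mul]
    ring

theorem coeFn_weightedFourierHs (hs : s ∈ Set.Ioo (0 : ℝ) 1) (hm : 0 < m) (u : Hs s) :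
    weightedFourierHs hs hm u =ᵐ[volume]
      fun η => (weight s m η : ℂ) * (𝓕 (u : L2) : L2) η :=
  MemLp.coeFn_toLp (memLp_weight_mul_of_mem hs hm u)

theorem norm_weightedFourierHs (hs : s ∈ Set.Ioo (0 : ℝ) 1) (hm : 0 < m) (u : Hs s) :
    ‖weightedFourierHs hs hm u‖ = hsmNorm s m u :=
  norm_toLp_weight_mul _ (memLp_weight_mul_of_mem hs hm u)

/-- Injectivity holds because the weight has no zeros and `𝓕` is injective. A preimage of `g` is `𝓕⁻
(g / w)`, which lies in `L²` since `1 / w ≤ m^(-s)`, and in `H^s` since its weighted transform is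
`g`. -/
theorem bijective_weightedFourierHs (hs : s ∈ Set.Ioo (0 : ℝ) 1) (hm : 0 < m) :
    Function.Bijective (weightedFourierHs hs hm) := by
  have hne (η : R3) : (weight s m η : ℂ) ≠ 0 :=
    Complex.ofReal_ne_zero.2 (weight_pos hm s η).ne'
  constructor
  · rw [← LinearMap.ker_eq_bot, LinearMap.ker_eq_bot']
    intro u hu
    have h := coeFn_weightedFourierHs hs hm u
    rw [hu] at h
    have h0 : (𝓕 (u : L2) : L2) = 0 := by
      refine Lp.ext ?_
      filter_upwards [h, Lp.coeFn_zero ℂ 2 (volume : Measure R3)] with η h1 h2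
      rw [h2, Pi.zero_apply, eq_comm, mul_eq_zero] at h1
      rw [h2, h1.resolve_left (hne η), Pi.zero_apply]
    refine Subtype.ext ?_
    rw [← FourierTransform.fourierInv_fourier_eq (F := L2) (u : L2), h0]
    exact (Lp.fourierTransformₗᵢ R3 ℂ).symm.map_zero
  · intro g
    have hb : AEStronglyMeasurable (fun η => ((weight s m η : ℂ))⁻¹) volume :=
      (Complex.measurable_ofReal.comp (measurable_weight s m)).inv.aestronglyMeasurable
    have hC (η : R3) : ‖((weight s m η : ℂ))⁻¹‖ ≤ (m ^ s)⁻¹ := by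
      rw [norm_inv, Complex.norm_real, Real.norm_of_nonneg (weight_pos hm s η).le]
      exact inv_anti₀ (Real.rpow_pos_of_pos hm s) (le_weight hs hm η)
    set u : L2 := 𝓕⁻ (mulL2 _ hb _ hC g) with hu_def
    have hFu : (𝓕 u : L2) = mulL2 _ hb _ hC g := FourierTransform.fourier_fourierInv_eq _
    have hae : (fun η => (weight s m η : ℂ) * (𝓕 u : L2) η) =ᵐ[volume] g := by
      rw [hFu]
      filter_upwards [coeFn_mulL2 _ hb _ hC g] with η h
      rw [h, mul_inv_cancel_left₀ (hne η)]
    have hu : u ∈ Hs s := by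
      rw [mem_Hs_iff_integrable hs hm, ← memLp_weight_mul_iff]
      exact (Lp.memLp g).ae_eq hae.symm
    exact ⟨⟨u, hu⟩, Lp.ext ((coeFn_weightedFourierHs hs hm ⟨u, hu⟩).trans hae)⟩

/-- The identification of the completion `H^s_m` with `H^s`. -/
noncomputable def hsmEquivHs (hs : s ∈ Set.Ioo (0 : ℝ) 1) (hm : 0 < m) :
    Hsm s m hs hm ≃ₗ[ℂ] Hs s :=
  (weightedFourierHsm hs hm).toLinearEquiv.trans
    (LinearEquiv.ofBijective _ (bijective_weightedFourierHs hs hm)).symm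

theorem weightedFourierHs_hsmEquivHs (hs : s ∈ Set.Ioo (0 : ℝ) 1) (hm : 0 < m)
    (v : Hsm s m hs hm) :
    weightedFourierHs hs hm (hsmEquivHs hs hm v) = weightedFourierHsm hs hm v :=
  (LinearEquiv.ofBijective _ (bijective_weightedFourierHs hs hm)).apply_symm_apply _

/-- Both sides have the same weighted transform, and that transform is injective on `H^s`. -/
theorem hsmEquivHs_coe (hs : s ∈ Set.Ioo (0 : ℝ) 1) (hm : 0 < m) (φ : TestHsm s m hs hm) :
    (hsmEquivHs hs hm (φ : Hsm s m hs hm) : L2) = φ.toL2 := by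
  have hφ : φ.toL2 ∈ Hs s := by
    rw [mem_Hs_iff_integrable hs hm, ← memLp_weight_mul_iff]
    exact φ.memLp_weight_mul
  have h : hsmEquivHs hs hm (φ : Hsm s m hs hm) = ⟨φ.toL2, hφ⟩ := by
    refine (bijective_weightedFourierHs hs hm).1 ?_
    rw [weightedFourierHs_hsmEquivHs, weightedFourierHsm_coe]
    rfl
  rw [h]

theorem norm_hsmEquivHs_symm (hs : s ∈ Set.Ioo (0 : ℝ) 1) (hm : 0 < m) (u : Hs s) :
    ‖(hsmEquivHs hs hm).symm u‖ = hsmNorm s m u := by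
  rw [← (weightedFourierHsm hs hm).norm_map, ← weightedFourierHs_hsmEquivHs,
    LinearEquiv.apply_symm_apply, norm_weightedFourierHs]

end

/-! ### Gaussian and Gamma integrals -/

open Set Real

/-- The squared modulus of `exp(-2πi z·η) - 1`. -/
noncomputable def phaseSq (z η : R3) : ℝ := ‖(𝐞 (-inner ℝ z η) : ℂ) - 1‖ ^ 2

theorem phaseSq_nonneg (z η : R3) : 0 ≤ phaseSq z η := sq_nonneg _

theorem phaseSq_eq (z η : R3) : phaseSq z η = 2 - 2 * Real.cos (2 * π * -inner ℝ z η) := by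
  rw [phaseSq, Real.fourierChar_apply, ← Complex.normSq_eq_norm_sq, Complex.normSq_apply]
  simp only [Complex.sub_re, Complex.sub_im, Complex.exp_ofReal_mul_I_re,
    Complex.exp_ofReal_mul_I_im, Complex.one_re, Complex.one_im]
  nlinarith [Real.sin_sq_add_cos_sq (2 * π * -inner ℝ z η)]

theorem measurable_phaseSq : Measurable fun p : R3 × R3 => phaseSq p.1 p.2 := by
  simp_rw [phaseSq_eq]
  fun_prop

theorem measurable_phaseSq_left (η : R3) : Measurable fun z : R3 => phaseSq z η := by
  simp_rw [phaseSq_eq]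
  fun_prop

theorem integrable_exp_neg_mul_sq_norm {b : ℝ} (hb : 0 < b) :
    Integrable (fun z : R3 => rexp (-b * ‖z‖ ^ 2)) volume := by
  have h := (GaussianFourier.integrable_cexp_neg_mul_sq_norm_add (V := R3) (b := b)
    (by simpa using hb) 0 0).norm
  refine h.congr (.of_forall fun z => ?_)
  simp only [Complex.norm_exp]
  congr 1
  simp [← Complex.ofReal_pow]

/-- Real part of the Fourier transform of a Gaussian. -/
theorem integral_cos_mul_exp_neg_mul_sq_norm {b : ℝ} (hb : 0 < b) (η : R3) :
    ∫ z : R3, Real.cos (2 * π * -inner ℝ z η) * rexp (-b * ‖z‖ ^ 2) =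
      (π / b) ^ (3 / 2 : ℝ) * rexp (-π ^ 2 * ‖η‖ ^ 2 / b) := by
  have h := fourier_gaussian_innerProductSpace (V := R3) (b := b) (by simpa using hb) η
  have hint : Integrable (fun z : R3 =>
      (𝐞 (-inner ℝ z η) : Circle) • Complex.exp (-(b : ℂ) * ‖z‖ ^ 2)) volume := by
    have h0 := (GaussianFourier.integrable_cexp_neg_mul_sq_norm_add (V := R3) (b := b)
      (by simpa using hb) 0 0)
    simp only [zero_mul, add_zero] at h0
    exact (Real.fourierIntegral_convergent_iff (μ := volume) η).2 h0
  rw [Real.fourier_eq] at h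
  have h2 := congrArg Complex.re h
  have h3 : (∫ z : R3, (𝐞 (-inner ℝ z η) : Circle) • Complex.exp (-(b : ℂ) * ‖z‖ ^ 2)).re =
      ∫ z : R3, ((𝐞 (-inner ℝ z η) : Circle) • Complex.exp (-(b : ℂ) * ‖z‖ ^ 2)).re :=
    (integral_re hint).symm
  rw [h3] at h2
  have h4 : ((π / b : ℂ) ^ (Module.finrank ℝ R3 / 2 : ℂ) *
      Complex.exp (-π ^ 2 * ‖η‖ ^ 2 / b)) =
      (((π / b) ^ (3 / 2 : ℝ) * rexp (-π ^ 2 * ‖η‖ ^ 2 / b) : ℝ) : ℂ) := by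
    rw [finrank_euclideanSpace_fin, Complex.ofReal_mul, Complex.ofReal_cpow (by positivity)]
    push_cast
    rfl
  rw [h4, Complex.ofReal_re] at h2
  rw [← h2]
  congr 1
  funext z
  have h5 : Complex.exp (-(b : ℂ) * ‖z‖ ^ 2) = ((rexp (-b * ‖z‖ ^ 2) : ℝ) : ℂ) := by
    push_cast; rfl
  rw [h5, Circle.smul_def, smul_eq_mul, Complex.re_mul_ofReal, Real.fourierChar_apply,
    Complex.exp_ofReal_mul_I_re]

theorem integrable_cos_mul_exp_neg_mul_sq_norm {b : ℝ} (hb : 0 < b) (η : R3) :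
    Integrable (fun z : R3 => Real.cos (2 * π * -inner ℝ z η) * rexp (-b * ‖z‖ ^ 2)) volume := by
  refine (integrable_exp_neg_mul_sq_norm hb).mono' (by fun_prop) (.of_forall fun z => ?_)
  rw [norm_mul, Real.norm_of_nonneg (Real.exp_pos _).le]
  exact mul_le_of_le_one_left (Real.exp_pos _).le (Real.abs_cos_le_one _)

theorem lintegral_phaseSq_mul_exp {b : ℝ} (hb : 0 < b) (η : R3) :
    ∫⁻ z : R3, ENNReal.ofReal (phaseSq z η * rexp (-b * ‖z‖ ^ 2)) =
      ENNReal.ofReal (2 * (π / b) ^ (3 / 2 : ℝ) * (1 - rexp (-π ^ 2 * ‖η‖ ^ 2 / b))) := by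
  have heq (z : R3) : phaseSq z η * rexp (-b * ‖z‖ ^ 2) =
      2 * rexp (-b * ‖z‖ ^ 2) -
        2 * (Real.cos (2 * π * -inner ℝ z η) * rexp (-b * ‖z‖ ^ 2)) := by
    rw [phaseSq_eq]; ring
  have h1 := (integrable_exp_neg_mul_sq_norm hb).const_mul 2
  have h2 := (integrable_cos_mul_exp_neg_mul_sq_norm hb η).const_mul 2
  rw [← ofReal_integral_eq_lintegral_ofReal ((h1.sub h2).congr (.of_forall fun z => (heq z).symm))
    (.of_forall fun z => mul_nonneg (phaseSq_nonneg z η) (Real.exp_pos _).le)]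
  congr 1
  simp_rw [heq]
  rw [integral_sub h1 h2, integral_const_mul, integral_const_mul,
    integral_cos_mul_exp_neg_mul_sq_norm hb, GaussianFourier.integral_rexp_neg_mul_sq_norm hb,
    finrank_euclideanSpace_fin]
  push_cast
  ring

theorem lintegral_exp_neg_mul_mul_rpow {s c : ℝ} (hs : s < 1) (hc : 0 < c) :
    ∫⁻ t in Ioi (0 : ℝ), ENNReal.ofReal (rexp (-(c * t)) * t ^ (-s)) =
      ENNReal.ofReal (c ^ (s - 1) * Gamma (1 - s)) := by
  have h := Real.integral_rpow_mul_exp_neg_mul_Ioi (a := 1 - s) (r := c) (by linarith) hc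
  have hpos : 0 < (1 / c) ^ (1 - s) * Gamma (1 - s) :=
    mul_pos (by positivity) (Real.Gamma_pos_of_pos (by linarith))
  have hint : Integrable (fun t : ℝ => t ^ (1 - s - 1) * rexp (-(c * t)))
      (volume.restrict (Ioi 0)) := by
    -- A non-integrable function has integral 0 by convention, whereas the Gamma value is positive.
    by_contra hcon
    rw [integral_undef hcon] at h
    exact hpos.ne h
  have hexp : (1 / c) ^ (1 - s) = c ^ (s - 1) := by
    rw [one_div, Real.inv_rpow hc.le, ← Real.rpow_neg hc.le, neg_sub]
  rw [← hexp, ← h, ofReal_integral_eq_lintegral_ofReal hint]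
  · refine lintegral_congr fun t => ?_
    rw [mul_comm, show 1 - s - 1 = -s by ring]
  · filter_upwards [ae_restrict_mem measurableSet_Ioi] with t ht
    have : (0 : ℝ) < t := ht
    simp only [Pi.zero_apply]
    positivity

theorem lintegral_Ioc_exp_neg_mul {t l : ℝ} (ht : 0 < t) (hl : 0 ≤ l) :
    ∫⁻ c in Ioc 1 (1 + l), ENNReal.ofReal (rexp (-(c * t))) =
      ENNReal.ofReal ((1 - rexp (-(l * t))) * rexp (-t) * t⁻¹) := by
  have hcont : Continuous fun c : ℝ => rexp (-(c * t)) := by fun_prop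
  rw [← ofReal_integral_eq_lintegral_ofReal
    ((hcont.intervalIntegrable 1 (1 + l)).1) (.of_forall fun c => (Real.exp_pos _).le),
    ← intervalIntegral.integral_of_le (by linarith)]
  congr 1
  have hderiv : ∀ c ∈ uIcc 1 (1 + l),
      HasDerivAt (fun c => -(rexp (-(c * t)) * t⁻¹)) (rexp (-(c * t))) c := fun c _ => by
    have := (((hasDerivAt_id c).mul_const t).neg.exp.mul_const t⁻¹).neg
    refine this.congr_deriv ?_
    simp only [id, Pi.neg_apply]
    field_simp
  rw [intervalIntegral.integral_eq_sub_of_hasDerivAt hderiv (hcont.intervalIntegrable _ _)]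
  rw [show -((1 + l) * t) = -(l * t) + -t by ring, Real.exp_add, one_mul]
  ring

/-- Write `(1 - exp(-l t)) exp(-t) / t` as the integral of `exp(-c t)` over `1 < c ≤ 1 + l`. Tonelli
then leaves the Gamma integral `c^(s-1) Γ(1-s)`, and integrating in `c` gives the result. -/
theorem lintegral_one_sub_exp_mul_rpow {s l : ℝ} (hs : s ∈ Ioo (0 : ℝ) 1) (hl : 0 ≤ l) :
    ∫⁻ t in Ioi (0 : ℝ), ENNReal.ofReal ((1 - rexp (-(l * t))) * rexp (-t) * t ^ (-1 - s)) =
      ENNReal.ofReal (Gamma (1 - s) / s * ((1 + l) ^ s - 1)) := by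
  have hs0 := hs.1
  have hs1 := hs.2
  have hΓ : 0 < Gamma (1 - s) := Real.Gamma_pos_of_pos (by linarith)
  calc _ = ∫⁻ t in Ioi (0 : ℝ), ∫⁻ c in Ioc 1 (1 + l),
        ENNReal.ofReal (rexp (-(c * t)) * t ^ (-s)) := by
        refine setLIntegral_congr_fun measurableSet_Ioi fun t (ht : 0 < t) => ?_
        simp_rw [ENNReal.ofReal_mul (Real.exp_pos _).le]
        rw [lintegral_mul_const _ (by fun_prop), lintegral_Ioc_exp_neg_mul ht hl,
          ← ENNReal.ofReal_mul' (by positivity)]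
        congr 1
        rw [show -1 - s = -1 + -s by ring, Real.rpow_add ht, Real.rpow_neg_one]
        ring
    _ = ∫⁻ c in Ioc 1 (1 + l), ∫⁻ t in Ioi (0 : ℝ),
        ENNReal.ofReal (rexp (-(c * t)) * t ^ (-s)) := by
        refine lintegral_lintegral_swap (Measurable.aemeasurable ?_)
        simp only [Function.uncurry_def]
        fun_prop
    _ = ∫⁻ c in Ioc 1 (1 + l), ENNReal.ofReal (c ^ (s - 1) * Gamma (1 - s)) := by
        refine setLIntegral_congr_fun measurableSet_Ioc fun c hc => ?_
        exact lintegral_exp_neg_mul_mul_rpow hs1 (by linarith [hc.1])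
    _ = _ := by
        have hint : IntervalIntegrable (fun c : ℝ => c ^ (s - 1)) volume 1 (1 + l) :=
          intervalIntegral.intervalIntegrable_rpow' (by linarith)
        rw [← ofReal_integral_eq_lintegral_ofReal (hint.1.mul_const _),
          ← intervalIntegral.integral_of_le (by linarith), intervalIntegral.integral_mul_const,
          integral_rpow (Or.inl (by linarith))]
        · congr 1
          rw [sub_add_cancel, Real.one_rpow]
          ring
        · filter_upwards [ae_restrict_mem measurableSet_Ioc] with c hc
          have : 0 < c := by linarith [hc.1]
          simp only [Pi.zero_apply]
          positivity

/-! The Bessel kernel -/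

/-- The bound `exp(-x) ≤ 4! / x^4` with `x = ζ² / (4t)` supplies a factor `t^4`, so the integrand is
dominated by a multiple of the integrand of `Γ(4 - ν)`. The power 4 suffices because the order `(3 +
2s) / 2` used later is below `5 / 2`. -/
theorem integrableOn_besselK_integrand {ν ζ : ℝ} (hν : ν < 4) (hζ : 0 < ζ) :
    IntegrableOn (fun t => rexp (-ζ ^ 2 / (4 * t) - t) * t ^ (-1 - ν)) (Ioi 0) volume := by
  have h := (Real.GammaIntegral_convergent (s := 4 - ν) (by linarith)).const_mul
    (24 / (ζ ^ 2 / 4) ^ 4)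
  refine Integrable.mono' h (Measurable.aestronglyMeasurable (by fun_prop)) ?_
  filter_upwards [ae_restrict_mem measurableSet_Ioi] with t ht
  replace ht : 0 < t := ht
  have h1 := Real.pow_div_factorial_le_exp (ζ ^ 2 / 4 / t) (by positivity) 4
  have h2 : rexp (-(ζ ^ 2 / 4 / t)) ≤ 24 / (ζ ^ 2 / 4) ^ 4 * t ^ 4 := by
    rw [Real.exp_neg]
    calc (rexp (ζ ^ 2 / 4 / t))⁻¹ ≤ ((ζ ^ 2 / 4 / t) ^ 4 / (Nat.factorial 4 : ℕ))⁻¹ :=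
          inv_anti₀ (by positivity) h1
      _ = _ := by
          norm_num [Nat.factorial]
          field_simp
  rw [Real.norm_of_nonneg (by positivity), show -ζ ^ 2 / (4 * t) - t = -(ζ ^ 2 / 4 / t) + -t by
    field_simp; ring, Real.exp_add]
  calc _ ≤ 24 / (ζ ^ 2 / 4) ^ 4 * t ^ 4 * rexp (-t) * t ^ (-1 - ν) := by gcongr
    _ = 24 / (ζ ^ 2 / 4) ^ 4 * (rexp (-t) * (t ^ 4 * t ^ (-1 - ν))) := by ring
    _ = _ := by
        rw [← Real.rpow_natCast t 4, ← Real.rpow_add ht]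
        congr 3
        push_cast
        ring

theorem besselK_nonneg (ν : ℝ) {ζ : ℝ} (hζ : 0 ≤ ζ) : 0 ≤ besselK ν ζ := by
  refine mul_nonneg (by positivity) (setIntegral_nonneg measurableSet_Ioi fun t ht => ?_)
  have : (0 : ℝ) < t := ht
  positivity

theorem measurable_besselK (ν : ℝ) : Measurable (besselK ν) := by
  have h : Measurable (Function.uncurry fun ζ t : ℝ =>
      rexp (-ζ ^ 2 / (4 * t) - t) * t ^ (-1 - ν)) := by
    simp only [Function.uncurry_def]
    fun_prop
  have h2 : Measurable fun ζ : ℝ =>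
      ∫ t in Ioi (0 : ℝ), rexp (-ζ ^ 2 / (4 * t) - t) * t ^ (-1 - ν) :=
    (h.stronglyMeasurable.integral_prod_right (ν := volume.restrict (Ioi 0))).measurable
  unfold besselK
  fun_prop

/-- The kernel `(C_s / 2) m^((3+2s)/2) K_((3+2s)/2)(m|z|) / |z|^((3+2s)/2)`. -/
noncomputable def besselKernel (s m : ℝ) (z : R3) : ℝ :=
  Cs s / 2 * m ^ ((3 + 2 * s) / 2) *
    (besselK ((3 + 2 * s) / 2) (m * ‖z‖) / ‖z‖ ^ ((3 + 2 * s) / 2))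

theorem Cs_pos {s : ℝ} (hs : s ∈ Ioo (0 : ℝ) 1) : 0 < Cs s := by
  have hs0 := hs.1
  have : 0 < Gamma (1 - s) := Real.Gamma_pos_of_pos (by linarith [hs.2])
  unfold Cs
  positivity

theorem besselKernel_nonneg {s m : ℝ} (hs : s ∈ Ioo (0 : ℝ) 1) (hm : 0 < m) (z : R3) :
    0 ≤ besselKernel s m z := by
  have h1 := Cs_pos hs
  have h2 := besselK_nonneg ((3 + 2 * s) / 2) (ζ := m * ‖z‖) (by positivity)
  unfold besselKernel
  positivity

theorem measurable_besselKernel (s m : ℝ) : Measurable (besselKernel s m) := by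
  have h := measurable_besselK ((3 + 2 * s) / 2)
  unfold besselKernel
  fun_prop

/-- Exhibits the kernel as a superposition of Gaussians in `z`, with a weight in `t` independent of
`z`. -/
theorem ofReal_besselKernel {s m : ℝ} (hs : s ∈ Ioo (0 : ℝ) 1) (hm : 0 < m) {z : R3}
    (hz : z ≠ 0) :
    ENNReal.ofReal (besselKernel s m z) = ∫⁻ t in Ioi (0 : ℝ),
      ENNReal.ofReal (rexp (-(m ^ 2 / (4 * t)) * ‖z‖ ^ 2)) *
        ENNReal.ofReal (Cs s / 4 * m ^ (3 + 2 * s) * 2 ^ (-((3 + 2 * s) / 2)) *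
          (rexp (-t) * t ^ (-1 - (3 + 2 * s) / 2))) := by
  have hs0 := hs.1
  have hs1 := hs.2
  have hz' : 0 < ‖z‖ := norm_pos_iff.2 hz
  set ν := (3 + 2 * s) / 2 with hν
  have hC := Cs_pos hs
  have hint := (integrableOn_besselK_integrand (ν := ν) (ζ := m * ‖z‖) (by rw [hν]; linarith)
    (by positivity)).const_mul (Cs s / 4 * m ^ (3 + 2 * s) * 2 ^ (-ν))
  -- The factor `(m|z|/2)^ν` in `besselK` cancels the division by `|z|^ν`, leaving `m^(2ν) 2^(-ν)`
  -- with `2ν = 3 + 2s`.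
  have heq : besselKernel s m z = ∫ t in Ioi (0 : ℝ), Cs s / 4 * m ^ (3 + 2 * s) * 2 ^ (-ν) *
      (rexp (-(m * ‖z‖) ^ 2 / (4 * t) - t) * t ^ (-1 - ν)) := by
    rw [integral_const_mul, besselKernel, besselK, ← hν,
      Real.div_rpow (by positivity) (by norm_num), Real.mul_rpow hm.le hz'.le, Real.rpow_neg (by norm_num),
      show 3 + 2 * s = ν + ν by rw [hν]; ring, Real.rpow_add hm]
    field_simp
    ring
  rw [heq, ofReal_integral_eq_lintegral_ofReal hint]
  · refine lintegral_congr fun t => ?_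
    rw [← ENNReal.ofReal_mul (Real.exp_pos _).le]
    congr 1
    rw [show -(m * ‖z‖) ^ 2 / (4 * t) - t = -(m ^ 2 / (4 * t)) * ‖z‖ ^ 2 + -t by ring,
      Real.exp_add]
    ring
  · filter_upwards [ae_restrict_mem measurableSet_Ioi] with t ht
    have : (0 : ℝ) < t := ht
    simp only [Pi.zero_apply]
    positivity

/-- This identity fixes the value of `C_s`: the factors on the left come from the kernel, the
Gaussian integral and the Gamma integral. -/
theorem Cs_mul_const {s m : ℝ} (hs : s ∈ Ioo (0 : ℝ) 1) (hm : 0 < m) :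
    Cs s / 4 * m ^ (3 + 2 * s) * 2 ^ (-((3 + 2 * s) / 2)) *
      (2 * (4 * π / m ^ 2) ^ (3 / 2 : ℝ)) * (Gamma (1 - s) / s) = m ^ (2 * s) := by
  have hs0 := hs.1
  have hΓ : 0 < Gamma (1 - s) := Real.Gamma_pos_of_pos (by linarith [hs.2])
  have h1 : (4 * π / m ^ 2) ^ (3 / 2 : ℝ) = 8 * π ^ (3 / 2 : ℝ) / m ^ (3 : ℝ) := by
    rw [Real.div_rpow (by positivity) (by positivity), Real.mul_rpow (by norm_num) (by positivity),
      ← Real.rpow_natCast m 2, ← Real.rpow_mul hm.le, show (4 : ℝ) = 2 ^ (2 : ℝ) by norm_num,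
      ← Real.rpow_mul (by norm_num)]
    norm_num
  have h2 : (2 : ℝ) ^ ((2 * s - 1) / 2) * 2 ^ (-((3 + 2 * s) / 2)) = 1 / 4 := by
    rw [← Real.rpow_add (by norm_num), show (2 * s - 1) / 2 + -((3 + 2 * s) / 2) = -2 by ring]
    norm_num
  have h3 : m ^ (3 + 2 * s) = m ^ (3 : ℝ) * m ^ (2 * s) := Real.rpow_add hm _ _
  rw [h1, h3, Cs]
  have : 0 < m ^ (3 : ℝ) := by positivity
  calc _ = 4 * ((2 : ℝ) ^ ((2 * s - 1) / 2) * 2 ^ (-((3 + 2 * s) / 2))) * m ^ (2 * s) := by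
        field_simp
        ring
    _ = _ := by rw [h2]; ring

/-- After Tonelli, the inner integral in `z` is Gaussian with parameter `b = m² / (4t)`. It produces
`t^(3/2)`, which lowers the order from `(3 + 2s) / 2` to `s`, and the factor `1 - exp(-l t)` with `l
= |2πη|² / m²`. The remaining integral in `t` is `lintegral_one_sub_exp_mul_rpow`, and `m^(2s) ((1 +
l)^s - 1)` is the asserted symbol. -/
theorem lintegral_phaseSq_mul_besselKernel {s m : ℝ}
    (hs : s ∈ Ioo (0 : ℝ) 1) (hm : 0 < m) (η : R3) :
    ∫⁻ z : R3, ENNReal.ofReal (phaseSq z η * besselKernel s m z) =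
      ENNReal.ofReal ((‖(2 * π) • η‖ ^ 2 + m ^ 2) ^ s - m ^ (2 * s)) := by
  have hs0 := hs.1
  have hs1 := hs.2
  have hC := Cs_pos hs
  have hΓ : 0 < Gamma (1 - s) := Real.Gamma_pos_of_pos (by linarith)
  set D := Cs s / 4 * m ^ (3 + 2 * s) * 2 ^ (-((3 + 2 * s) / 2)) with hD
  have hD0 : 0 < D := by positivity
  set l := ‖(2 * π) • η‖ ^ 2 / m ^ 2 with hl
  have hmeas := measurable_phaseSq_left η
  have hnn := phaseSq_nonneg
  calc _ = ∫⁻ z : R3, ∫⁻ t in Ioi (0 : ℝ),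
        ENNReal.ofReal (phaseSq z η * rexp (-(m ^ 2 / (4 * t)) * ‖z‖ ^ 2)) *
        ENNReal.ofReal (D * (rexp (-t) * t ^ (-1 - (3 + 2 * s) / 2))) := by
        refine lintegral_congr_ae ?_
        -- The Gaussian representation is available only away from the origin, a null set.
        filter_upwards [compl_mem_ae_iff.2 (measure_singleton (0 : R3))] with z hz
        rw [ENNReal.ofReal_mul (hnn z η), ofReal_besselKernel hs hm hz, ← hD,
          ← lintegral_const_mul _ (by fun_prop)]
        refine lintegral_congr fun t => ?_
        rw [ENNReal.ofReal_mul (hnn z η)]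
        exact (mul_assoc _ _ _).symm
    _ = ∫⁻ t in Ioi (0 : ℝ), ∫⁻ z : R3,
        ENNReal.ofReal (phaseSq z η * rexp (-(m ^ 2 / (4 * t)) * ‖z‖ ^ 2)) *
        ENNReal.ofReal (D * (rexp (-t) * t ^ (-1 - (3 + 2 * s) / 2))) := by
        refine lintegral_lintegral_swap (Measurable.aemeasurable ?_)
        simp only [Function.uncurry_def]
        fun_prop
    _ = ∫⁻ t in Ioi (0 : ℝ), ENNReal.ofReal (D * (2 * (4 * π / m ^ 2) ^ (3 / 2 : ℝ))) *
        ENNReal.ofReal ((1 - rexp (-(l * t))) * rexp (-t) * t ^ (-1 - s)) := by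
        refine setLIntegral_congr_fun measurableSet_Ioi fun t (ht : 0 < t) => ?_
        rw [lintegral_mul_const _ (by fun_prop),
          lintegral_phaseSq_mul_exp (by positivity),
          ← ENNReal.ofReal_mul' (by positivity), ← ENNReal.ofReal_mul (by positivity)]
        congr 1
        have h1 : π / (m ^ 2 / (4 * t)) = 4 * π / m ^ 2 * t := by field_simp
        have h2 : -π ^ 2 * ‖η‖ ^ 2 / (m ^ 2 / (4 * t)) = -(l * t) := by
          rw [hl, norm_smul, Real.norm_of_nonneg (by positivity)]
          field_simp
          ring
        have h3 : t ^ (-1 - s) = t ^ (3 / 2 : ℝ) * t ^ (-1 - (3 + 2 * s) / 2) := by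
          rw [← Real.rpow_add ht]; congr 1; ring
        rw [h1, h2, h3, Real.mul_rpow (by positivity) ht.le]
        ring
    _ = _ := by
        rw [lintegral_const_mul _ (by fun_prop), lintegral_one_sub_exp_mul_rpow hs (by positivity),
          ← ENNReal.ofReal_mul (by positivity), ← mul_assoc, Cs_mul_const hs hm]
        congr 1
        have h4 : ‖(2 * π) • η‖ ^ 2 + m ^ 2 = m ^ 2 * (1 + l) := by
          rw [hl]; field_simp; ring
        rw [h4, Real.mul_rpow (by positivity) (by positivity), Real.rpow_mul hm.le, Real.rpow_two]
        ring

/-! ### Translations and Plancherel -/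

/-- Translation by `a` on `L²`. -/
noncomputable def translate (a : R3) : L2 →+ L2 :=
  Lp.compMeasurePreserving (fun x => x - a) (measurePreserving_sub_right volume a)

theorem coeFn_translate (a : R3) (u : L2) : translate a u =ᵐ[volume] fun x => u (x - a) :=
  Lp.coeFn_compMeasurePreserving u (measurePreserving_sub_right volume a)

theorem continuous_translate (a : R3) : Continuous (translate a) :=
  (Lp.isometry_compMeasurePreserving (measurePreserving_sub_right volume a)).continuous

theorem continuous_fourierChar_inner_right (a : R3) :
    Continuous fun η : R3 => (𝐞 (-inner ℝ a η) : ℂ) := by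
  have := Real.continuous_fourierChar
  fun_prop

theorem fourier_compSubConst (f : SchwartzMap R3 ℂ) (a η : R3) :
    (𝓕 (f.compSubConstCLM ℂ a) : SchwartzMap R3 ℂ) η =
      (𝐞 (-inner ℝ a η) : ℂ) * (𝓕 f : SchwartzMap R3 ℂ) η := by
  have h := congrFun (VectorFourier.fourierIntegral_comp_add_right 𝐞 (volume : Measure R3)
    (innerₗ R3) f (-a)) η
  simp only [innerₗ_apply_apply, inner_neg_left, Circle.smul_def, smul_eq_mul] at h
  rw [SchwartzMap.fourier_coe, SchwartzMap.fourier_coe]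
  refine Eq.trans ?_ h
  congr 1

/-- Both sides are continuous in `u` as elements of `L²`, so it suffices to check Schwartz
functions, where the transform is an integral and translation is a change of variables. -/
theorem coeFn_fourier_translate (a : R3) (u : L2) :
    ⇑(𝓕 (translate a u) : L2) =ᵐ[volume]
      fun η => (𝐞 (-inner ℝ a η) : ℂ) * (𝓕 u : L2) η := by
  set M := mulL2 (fun η => (𝐞 (-inner ℝ a η) : ℂ))
    (continuous_fourierChar_inner_right a).aestronglyMeasurable 1
    (fun η => (Circle.norm_coe _).le) with hM
  have key : ∀ u : L2, (𝓕 (translate a u) : L2) = M (𝓕 u : L2) := by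
    have hF : Continuous (fun u : L2 => (𝓕 u : L2)) := (Lp.fourierTransformₗᵢ R3 ℂ).continuous
    refine isClosed_property
      (SchwartzMap.denseRange_toLpCLM (E := R3) (F := ℂ) (p := 2) (μ := volume)
        ENNReal.ofNat_ne_top)
      (isClosed_eq (hF.comp (continuous_translate a)) (M.continuous.comp hF)) fun f => ?_
    have h1 : translate a (f.toLp 2) = (f.compSubConstCLM ℂ a).toLp 2 := by
      refine Lp.ext ?_
      filter_upwards [coeFn_translate a (f.toLp 2), (f.compSubConstCLM ℂ a).coeFn_toLp 2 volume,
        (measurePreserving_sub_right volume a).quasiMeasurePreserving.ae (f.coeFn_toLp 2 volume)]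
        with x h1 h2 h3
      rw [h1, h2, h3, SchwartzMap.compSubConstCLM_apply]
    rw [SchwartzMap.toLpCLM_apply, h1, SchwartzMap.toLp_fourier_eq, SchwartzMap.toLp_fourier_eq]
    refine Lp.ext ?_
    filter_upwards [coeFn_mulL2 _ (continuous_fourierChar_inner_right a).aestronglyMeasurable 1
      (fun η => (Circle.norm_coe _).le) ((𝓕 f : SchwartzMap R3 ℂ).toLp 2),
      (𝓕 f : SchwartzMap R3 ℂ).coeFn_toLp 2 volume,
      (𝓕 (f.compSubConstCLM ℂ a) : SchwartzMap R3 ℂ).coeFn_toLp 2 volume] with η h1 h2 h3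
    rw [h3, hM, h1, h2, fourier_compSubConst]
  rw [key]
  exact coeFn_mulL2 _ _ _ _ _

theorem integral_norm_sq (u : L2) : ∫ x, ‖u x‖ ^ 2 = ‖u‖ ^ 2 := by
  rw [Lp.norm_def, (Lp.memLp u).eLpNorm_eq_integral_rpow_norm (by simp) (by simp),
    ENNReal.toReal_ofReal (by positivity)]
  simp only [ENNReal.toReal_ofNat, Real.rpow_ofNat, inv_eq_one_div]
  rw [← Real.sqrt_eq_rpow, Real.sq_sqrt (integral_nonneg fun _ => sq_nonneg _)]

theorem lintegral_norm_sq_eq (u : L2) :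
    ∫⁻ x, ENNReal.ofReal (‖u x‖ ^ 2) = ENNReal.ofReal (‖u‖ ^ 2) := by
  rw [← integral_norm_sq, ofReal_integral_eq_lintegral_ofReal
    ((memLp_two_iff_integrable_sq_norm (Lp.aestronglyMeasurable u)).1 (Lp.memLp u))
    (.of_forall fun _ => sq_nonneg _)]

/-- Plancherel for the difference of `u` and its translate, whose transform is `𝓕u` times `exp(-2πi
a·η) - 1` up to sign. -/
theorem lintegral_norm_sub_translate_sq (a : R3) (u : L2) :
    ∫⁻ x, ENNReal.ofReal (‖u x - u (x - a)‖ ^ 2) =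
      ∫⁻ η, ENNReal.ofReal (phaseSq a η * ‖(𝓕 u : L2) η‖ ^ 2) := by
  have hF : (𝓕 (translate a u - u) : L2) = 𝓕 (translate a u) - 𝓕 u :=
    (Lp.fourierTransformₗᵢ R3 ℂ).map_sub _ _
  calc _ = ∫⁻ x, ENNReal.ofReal (‖(translate a u - u) x‖ ^ 2) := by
        refine lintegral_congr_ae ?_
        filter_upwards [Lp.coeFn_sub (translate a u) u, coeFn_translate a u] with x h1 h2
        rw [h1, Pi.sub_apply, h2, norm_sub_rev]
    _ = ∫⁻ η, ENNReal.ofReal (‖(𝓕 (translate a u - u) : L2) η‖ ^ 2) := by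
        rw [lintegral_norm_sq_eq, lintegral_norm_sq_eq, Lp.norm_fourier_eq]
    _ = _ := by
        refine lintegral_congr_ae ?_
        rw [hF]
        filter_upwards [Lp.coeFn_sub (𝓕 (translate a u) : L2) (𝓕 u), coeFn_fourier_translate a u]
          with η h1 h2
        rw [h1, Pi.sub_apply, h2, ← sub_one_mul, norm_mul, mul_pow, phaseSq]

/-! ### The nonlocal energy -/

theorem const_mul_besselIntegrand (s m : ℝ) (u : R3 → ℂ) (p : R3 × R3) :
    Cs s / 2 * m ^ ((3 + 2 * s) / 2) * besselIntegrand s m u p =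
      ‖u p.1 - u p.2‖ ^ 2 * besselKernel s m (p.1 - p.2) := by
  rw [besselIntegrand, besselKernel]
  ring

theorem measurable_besselIntegrand (s m : ℝ) {u : R3 → ℂ} (hu : Measurable u) :
    Measurable (besselIntegrand s m u) := by
  have h := measurable_besselK ((3 + 2 * s) / 2)
  unfold besselIntegrand
  fun_prop

theorem besselIntegrand_nonneg (s : ℝ) {m : ℝ} (hm : 0 < m) (u : R3 → ℂ) (p : R3 × R3) :
    0 ≤ besselIntegrand s m u p := by
  have h := besselK_nonneg ((3 + 2 * s) / 2) (ζ := m * ‖p.1 - p.2‖) (by positivity)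
  unfold besselIntegrand
  positivity

/-- Substituting `z = x - y` makes the kernel depend on `z` alone, so Plancherel applies in `x` for
each fixed `z`; a second exchange then integrates `z` out and leaves the symbol. Valid for every `u`
in `L²`, with both sides possibly infinite. -/
theorem lintegral_besselIntegrand {s m : ℝ} (hs : s ∈ Ioo (0 : ℝ) 1) (hm : 0 < m) (u : L2) :
    ∫⁻ p, ENNReal.ofReal (Cs s / 2 * m ^ ((3 + 2 * s) / 2) * besselIntegrand s m u p) =
      ∫⁻ η, ENNReal.ofReal
        (((‖(2 * π) • η‖ ^ 2 + m ^ 2) ^ s - m ^ (2 * s)) * ‖(𝓕 u : L2) η‖ ^ 2) := by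
  have hk := measurable_besselKernel s m
  have hk0 := besselKernel_nonneg hs hm
  have hu : Measurable u := (Lp.stronglyMeasurable u).measurable
  have hFu : Measurable (𝓕 u : L2) := (Lp.stronglyMeasurable (𝓕 u : L2)).measurable
  have he := measurable_phaseSq
  have he0 := phaseSq_nonneg
  simp_rw [const_mul_besselIntegrand]
  calc _ = ∫⁻ x, ∫⁻ y, ENNReal.ofReal (‖u x - u y‖ ^ 2 * besselKernel s m (x - y)) := by
        rw [Measure.volume_eq_prod]
        exact lintegral_prod _ (Measurable.aemeasurable (by fun_prop))
    _ = ∫⁻ x, ∫⁻ z, ENNReal.ofReal (‖u x - u (x - z)‖ ^ 2 * besselKernel s m z) := by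
        refine lintegral_congr fun x => ?_
        rw [← lintegral_sub_left_eq_self _ x]
        simp only [sub_sub_cancel]
    _ = ∫⁻ z, ∫⁻ x, ENNReal.ofReal (‖u x - u (x - z)‖ ^ 2 * besselKernel s m z) := by
        refine lintegral_lintegral_swap (Measurable.aemeasurable ?_)
        simp only [Function.uncurry_def]
        fun_prop
    _ = ∫⁻ z, ∫⁻ η, ENNReal.ofReal (phaseSq z η * besselKernel s m z *
          ‖(𝓕 u : L2) η‖ ^ 2) := by
        refine lintegral_congr fun z => ?_
        simp_rw [fun η => mul_right_comm (phaseSq z η) (besselKernel s m z),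
          ENNReal.ofReal_mul' (hk0 z)]
        rw [lintegral_mul_const _ (by fun_prop), lintegral_mul_const _ (by fun_prop),
          lintegral_norm_sub_translate_sq]
    _ = ∫⁻ η, ∫⁻ z, ENNReal.ofReal (phaseSq z η * besselKernel s m z *
          ‖(𝓕 u : L2) η‖ ^ 2) := by
        refine lintegral_lintegral_swap (Measurable.aemeasurable ?_)
        simp only [Function.uncurry_def]
        fun_prop
    _ = _ := by
        refine lintegral_congr fun η => ?_
        simp_rw [ENNReal.ofReal_mul' (sq_nonneg ‖(𝓕 u : L2) η‖)]
        rw [lintegral_mul_const _ (by fun_prop),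
          lintegral_phaseSq_mul_besselKernel hs hm]

theorem besselIntegrand_integrable_and_integral {s m : ℝ} (hs : s ∈ Ioo (0 : ℝ) 1) (hm : 0 < m)
    (u : Hs s) :
    Integrable (besselIntegrand s m (u : L2)) volume ∧
      Cs s / 2 * m ^ ((3 + 2 * s) / 2) * (∫ p, besselIntegrand s m (u : L2) p) +
        m ^ (2 * s) * ∫ x, ‖(u : L2) x‖ ^ 2 =
      ∫ ξ, (‖ξ‖ ^ 2 + m ^ 2) ^ s * ‖fourier u ξ‖ ^ 2 := by
  have hC := Cs_pos hs
  have hc : 0 < Cs s / 2 * m ^ ((3 + 2 * s) / 2) := by positivity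
  have hF : Integrable (fun η => (‖(2 * π) • η‖ ^ 2 + m ^ 2) ^ s * ‖(𝓕 (u : L2) : L2) η‖ ^ 2) :=
    (integrable_mul_fourier_iff (fun ξ => (‖ξ‖ ^ 2 + m ^ 2) ^ s) u).1
      ((mem_Hs_iff_integrable hs hm _).1 u.2)
  have hF2 : Integrable (fun η => m ^ (2 * s) * ‖(𝓕 (u : L2) : L2) η‖ ^ 2) :=
    ((memLp_two_iff_integrable_sq_norm (Lp.aestronglyMeasurable _)).1 (Lp.memLp _)).const_mul _
  have hsub : Integrable (fun η => ((‖(2 * π) • η‖ ^ 2 + m ^ 2) ^ s - m ^ (2 * s)) *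
      ‖(𝓕 (u : L2) : L2) η‖ ^ 2) := by
    simp_rw [sub_mul]; exact hF.sub hF2
  have hnn (η : R3) : 0 ≤ ((‖(2 * π) • η‖ ^ 2 + m ^ 2) ^ s - m ^ (2 * s)) *
      ‖(𝓕 (u : L2) : L2) η‖ ^ 2 := by
    refine mul_nonneg (sub_nonneg.2 ?_) (sq_nonneg _)
    rw [Real.rpow_mul hm.le, Real.rpow_two]
    exact Real.rpow_le_rpow (by positivity) (by nlinarith [sq_nonneg ‖(2 * π) • η‖]) hs.1.le
  have hlin := lintegral_besselIntegrand hs hm (u : L2)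
  have hmeas := measurable_besselIntegrand s m (Lp.stronglyMeasurable (u : L2)).measurable
  have hB0 (p : R3 × R3) : 0 ≤ Cs s / 2 * m ^ ((3 + 2 * s) / 2) *
      besselIntegrand s m (u : L2) p := mul_nonneg hc.le (besselIntegrand_nonneg s hm _ p)
  have hint : Integrable (fun p => Cs s / 2 * m ^ ((3 + 2 * s) / 2) *
      besselIntegrand s m (u : L2) p) volume := by
    -- Finiteness is read off the Fourier side, where it is membership of `u` in `H^s`.
    refine (lintegral_ofReal_ne_top_iff_integrable
      (hmeas.const_mul _).aestronglyMeasurable (.of_forall hB0)).1 ?_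
    rw [hlin]
    exact hsub.lintegral_lt_top.ne
  refine ⟨(integrable_const_mul_iff (IsUnit.mk0 _ hc.ne') _).1 hint, ?_⟩
  have h1 : Cs s / 2 * m ^ ((3 + 2 * s) / 2) * (∫ p, besselIntegrand s m (u : L2) p) =
      ∫ η, ((‖(2 * π) • η‖ ^ 2 + m ^ 2) ^ s - m ^ (2 * s)) * ‖(𝓕 (u : L2) : L2) η‖ ^ 2 := by
    rw [← integral_const_mul, integral_eq_lintegral_of_nonneg_ae (.of_forall hB0) hint.1, hlin,
      integral_eq_lintegral_of_nonneg_ae (.of_forall hnn) hsub.1]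
  -- By Plancherel the `L²` term becomes `m^(2s) ∫ |𝓕u|²`, which cancels the subtracted part of the
  -- symbol.
  rw [h1, integral_mul_fourier (fun ξ => (‖ξ‖ ^ 2 + m ^ 2) ^ s), integral_norm_sq,
    ← Lp.norm_fourier_eq, ← integral_norm_sq, ← integral_const_mul]
  simp_rw [sub_mul]
  rw [integral_sub hF hF2, sub_add_cancel]

end PseudoRel


theorem mainTheorem9 (s m : ℝ) (hs : s ∈ Set.Ioo (0 : ℝ) 1) (hm : 0 < m) :
    -- the identity of `C_c^∞` extends to a linear bijection of `H^s_m` onto `H^s`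
    ∃ J : PseudoRel.Hsm s m hs hm ≃ₗ[ℂ] PseudoRel.Hs s,
      (∀ φ : PseudoRel.TestHsm s m hs hm,
        (J (φ : PseudoRel.Hsm s m hs hm) : PseudoRel.L2) = φ.toL2) ∧
      -- the two norms are equivalent
      (∃ c C : ℝ, 0 < c ∧ 0 < C ∧ ∀ u : PseudoRel.Hs s,
        c * PseudoRel.hsNorm s m u ≤ ‖J.symm u‖ ∧ ‖J.symm u‖ ≤ C * PseudoRel.hsNorm s m u) ∧
      -- the norm of `H^s_m` on all of `H^s`, through the symbol and through the Bessel kernel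
      ∀ u : PseudoRel.Hs s,
        MeasureTheory.Integrable (fun ξ : PseudoRel.R3 =>
          (‖ξ‖ ^ 2 + m ^ 2) ^ s * ‖PseudoRel.fourier u ξ‖ ^ 2) MeasureTheory.volume ∧
        MeasureTheory.Integrable (PseudoRel.besselIntegrand s m (u : PseudoRel.L2))
          MeasureTheory.volume ∧
        ‖J.symm u‖ = PseudoRel.hsmNorm s m u ∧
        PseudoRel.hsmNorm s m u =
          √(PseudoRel.Cs s / 2 * m ^ ((3 + 2 * s) / 2) *
              (∫ p : PseudoRel.R3 × PseudoRel.R3,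
                PseudoRel.besselIntegrand s m (u : PseudoRel.L2) p) +
            m ^ (2 * s) * ∫ x : PseudoRel.R3, ‖(u : PseudoRel.L2) x‖ ^ 2) := by
  refine ⟨PseudoRel.hsmEquivHs hs hm, PseudoRel.hsmEquivHs_coe hs hm,
    -- The constants are those of `hsNorm_le_hsmNorm` and `hsmNorm_le_hsNorm`.
    ⟨(√2)⁻¹, 1, by positivity, one_pos, fun u => ?_⟩, fun u => ?_⟩
  · rw [PseudoRel.norm_hsmEquivHs_symm, one_mul, inv_mul_le_iff₀ (by positivity)]
    exact ⟨PseudoRel.hsNorm_le_hsmNorm hs hm u, PseudoRel.hsmNorm_le_hsNorm hs hm u⟩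
  · obtain ⟨h1, h2⟩ := PseudoRel.besselIntegrand_integrable_and_integral hs hm u
    refine ⟨(PseudoRel.mem_Hs_iff_integrable hs hm _).1 u.2, h1,
      PseudoRel.norm_hsmEquivHs_symm hs hm u, ?_⟩
    rw [h2]
    rfl
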